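/- Let $\Omega_1,\Omega_2\subset\mathbb R^d$ be non-empty, bounded, connected open sets, and let $L^2(\Omega_j)$ denote the space of complex-valued square-integrable functions with respect to Lebesgue measure. For $j=1,2$ let $A_j$ be a self-adjoint operator on $L^2(\Omega_j)$ which is bounded from below and has compact resolvent, and let $S_j=(S_j(t))_{t\ge 0}$ be the strongly continuous semigroup generated by $-A_j$. Assume that $S_j$ is positive (i.e. $S_j(t)f\ge 0$ for all $t\ge0$ and $0\le f\in L^2(\Omega_j)$) and irreducible (i.e. if $\omega\subset\Omega_j$ is measurable and the closed ideal $J=\{f\in L^2(\Omega_j): f=0 \text{ a.e. on } \omega\}$ satisfies $S_j(t)J\subset J$ for all $t\ge 0$, then $J=\{0\}$ or $J=L^2(\Omega_j)$). Assume also that $\lambda_1(A_1)=\lambda_1(A_2)$, where $\lambda_1(A_j)$ denotes the smallest eigenvalue of $A_j$. Let $U\colon L^2(\Omega_1)\to L^2(\Omega_2)$ be a non-zero bounded linear operator which is disjointness-preserving, that is, $|f|\wedge|g|=0$ a.e. implies $|Uf|\wedge|Ug|=0$ a.e. for all $f,g\in L^2(\Omega_1)$, and suppose that $$US_1(t)=S_2(t)U\qquad\text{for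 all } t\ge 0 .$$ Then there is a unique positive bounded linear operator $|U|\colon L^2(\Omega_1)\to L^2(\Omega_2)$ (the modulus of $U$) such that $|U|f=|Uf|$ for all $0\le f\in L^2(\Omega_1)$, and $$|U|S_1(t)=S_2(t)|U|\qquad\text{for all } t\ge 0 .$$ If, in addition, there exist $c>0$ and an isometry $\tau\colon\mathbb R^d\to\mathbb R^d$ such that $\tau(\Omega_2)=\Omega_1$ and $|U|f=c\,f\circ\tau$ for all $f\in L^2(\Omega_1)$, then there exists a constant $c_1\in\mathbb C$ such that $$Uf=c_1\,f\circ\tau\qquad\text{for all } f\in L^2(\Omega_1).$$ -/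

import Mathlib

open MeasureTheory Filter Topology
open scoped NNReal

namespace DisjL2

section Lattice

variable {α β : Type*} [MeasurableSpace α] [MeasurableSpace β] {μ : Measure α} {ν : Measure β}

/-- `f ≥ 0` in the complex Banach lattice `L²(μ)`: `f` is real and nonnegative almost everywhere. -/
def Nonneg (f : Lp ℂ 2 μ) : Prop :=
  ∀ᵐ x ∂μ, (f x).im = 0 ∧ 0 ≤ (f x).re

/-- A bounded operator between complex `L²` spaces is positive if it maps nonnegative functions
to nonnegative functions. -/
def PositiveOp (T : Lp ℂ 2 μ →L[ℂ] Lp ℂ 2 ν) : Prop :=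
  ∀ f : Lp ℂ 2 μ, Nonneg f → Nonneg (T f)

/-- Disjointness preservation: `|f| ∧ |g| = 0` implies `|U f| ∧ |U g| = 0`
(the lattice infimum in `L²` is the pointwise minimum). -/
def DisjointnessPreserving (U : Lp ℂ 2 μ →L[ℂ] Lp ℂ 2 ν) : Prop :=
  ∀ f g : Lp ℂ 2 μ, (∀ᵐ x ∂μ, min ‖f x‖ ‖g x‖ = 0) → ∀ᵐ y ∂ν, min ‖U f y‖ ‖U g y‖ = 0

/-- `V` is a modulus operator `|U|` of `U`: a positive operator with `V f = |U f|`
for all `f ≥ 0`. -/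
def IsModulus (U V : Lp ℂ 2 μ →L[ℂ] Lp ℂ 2 ν) : Prop :=
  PositiveOp V ∧ ∀ f : Lp ℂ 2 μ, Nonneg f → ∀ᵐ y ∂ν, V f y = ((‖U f y‖ : ℝ) : ℂ)

/-- The closed ideal `{f ∈ L²(μ) : f = 0 a.e. on ω}` of `L²(μ)`. -/
def closedIdeal (μ : Measure α) (ω : Set α) : Submodule ℂ (Lp ℂ 2 μ) where
  carrier := {f | ∀ᵐ x ∂μ, x ∈ ω → f x = 0}
  zero_mem' := by
    filter_upwards [Lp.coeFn_zero ℂ 2 μ] with x hx _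
    simpa using hx
  add_mem' := by
    intro f g hf hg
    filter_upwards [hf, hg, Lp.coeFn_add f g] with x h1 h2 h3 hx
    have h4 : (f + g : Lp ℂ 2 μ) x = f x + g x := h3
    exact h4.trans (by rw [h1 hx, h2 hx, add_zero])
  smul_mem' := by
    intro c f hf
    filter_upwards [hf, Lp.coeFn_smul c f] with x h1 h2 hx
    simp [h2, h1 hx]

end Lattice

/-- A strongly continuous one-parameter semigroup of bounded operators on `H`. -/
structure C0Semigroup (H : Type*) [NormedAddCommGroup H] [NormedSpace ℂ H] where
  op : ℝ≥0 → H →L[ℂ] H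
  op_zero : op 0 = ContinuousLinearMap.id ℂ H
  op_add : ∀ s t : ℝ≥0, op (s + t) = (op s).comp (op t)
  strongly_continuous : ∀ x : H, Continuous fun t : ℝ≥0 => op t x

/-- `B` is the (infinitesimal) generator of `S`: `x ∈ D(B)` and `B x = y` if and only if
`(S(t) x - x) / t → y` as `t ↓ 0`. -/
def C0Semigroup.IsGenerator {H : Type*} [NormedAddCommGroup H] [NormedSpace ℂ H]
    (S : C0Semigroup H) (B : H →ₗ.[ℂ] H) : Prop :=
  ∀ x y : H, (x, y) ∈ B.graph ↔
    Tendsto (fun t : ℝ≥0 => ((t : ℝ) : ℂ)⁻¹ • (S.op t x - x)) (𝓝[>] 0) (𝓝 y)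

section Operators

variable {H : Type*} [NormedAddCommGroup H] [InnerProductSpace ℂ H]

/-- `A` is bounded from below: `⟨A x, x⟩ ≥ γ ‖x‖²` on `D(A)` for some real `γ`. -/
def BoundedFromBelow (A : H →ₗ.[ℂ] H) : Prop :=
  ∃ γ : ℝ, ∀ x : A.domain, γ * ‖(x : H)‖ ^ 2 ≤ (inner ℂ (A x) (x : H)).re

/-- `A` has compact resolvent: for some `z` in the resolvent set, `R = (z - A)⁻¹` is compact. -/
def HasCompactResolvent (A : H →ₗ.[ℂ] H) : Prop :=
  ∃ (z : ℂ) (R : H →L[ℂ] H), IsCompactOperator R ∧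
    (∀ f : H, ∃ h : R f ∈ A.domain, z • R f - A ⟨R f, h⟩ = f) ∧
    ∀ x : A.domain, R (z • (x : H) - A x) = x

/-- The first eigenvalue `λ₁(A)`: the infimum of the set of real eigenvalues of `A`. For a
self-adjoint operator on a nonzero space which is bounded from below and has compact resolvent,
this set is nonempty and discrete, and the infimum is its least element. -/
noncomputable def firstEigenvalue (A : H →ₗ.[ℂ] H) : ℝ :=
  sInf {l : ℝ | ∃ x : A.domain, (x : H) ≠ 0 ∧ A x = (l : ℂ) • (x : H)}

end Operators

section Semigroups

variable {α : Type*} [MeasurableSpace α] {μ : Measure α}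

/-- A semigroup on `L²(μ)` is positive if each of its operators is positive. -/
def C0Semigroup.Positive (S : C0Semigroup (Lp ℂ 2 μ)) : Prop :=
  ∀ t : ℝ≥0, PositiveOp (S.op t)

/-- A semigroup on `L²(μ)` is irreducible if the only closed ideals of `L²(μ)` that it leaves
invariant are `0` and `L²(μ)`. -/
def C0Semigroup.Irreducible (S : C0Semigroup (Lp ℂ 2 μ)) : Prop :=
  ∀ ω : Set α, MeasurableSet ω →
    (∀ t : ℝ≥0, ∀ f ∈ closedIdeal μ ω, S.op t f ∈ closedIdeal μ ω) →
      closedIdeal μ ω = ⊥ ∨ closedIdeal μ ω = ⊤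

end Semigroups

/-- The complex space `L²(Ω)` of an open set `Ω ⊆ ℝᵈ` with Lebesgue measure. -/
abbrev L2 {d : ℕ} (Ω : Set (EuclideanSpace ℝ (Fin d))) : Type :=
  Lp ℂ 2 ((volume : Measure (EuclideanSpace ℝ (Fin d))).restrict Ω)

end DisjL2

namespace DisjL2

/-! ### Semigroups and spectral theory of their generators -/

section Hilbert

variable {H : Type*} [NormedAddCommGroup H] [InnerProductSpace ℂ H]

/-! The operator `U` is a constant phase times a positive operator, and everything follows from
that. By Perron–Frobenius, each semigroup has an a.e. strictly positive ground state `wⱼ` with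
`Sⱼ(t) wⱼ = exp (-λ₁ t) wⱼ`, unique up to multiples (`exists_ground_state`). Since the two values of
`λ₁` agree, intertwining makes `U w₁` a ground state of `S₂`, so `U w₁ = a w₂`. Disjointness
preservation forces `U (1_A w₁)` to equal `0` or `U w₁` at almost every point. Hence with `c = |a| /
a` every `c U (1_A w₁)` is nonnegative, and strict positivity of `w₁` upgrades this to positivity of
`c U` (`positiveOp_of_restr`). The same argument excludes `a = 0`, because `U` would then vanish. As
`|c| = 1`, the modulus is `c U`; it inherits the intertwining by linearity, and any formula for it
gives one for `U` on dividing by `c`. The Perron–Frobenius part needs `exp (-λ₁ t)` to be both an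
eigenvalue of `S(t)` and a bound for its norm. Both come from the spectral theorem for the compact
self-adjoint operator `(A - m)⁻¹`, with `m` below the lower bound of `A`. -/

theorem C0Semigroup.hasDerivWithinAt_op (S : C0Semigroup H) {B : H →ₗ.[ℂ] H}
    (hgen : S.IsGenerator B) (x : B.domain) {t : ℝ} (ht : 0 ≤ t) :
    HasDerivWithinAt (fun s : ℝ => S.op s.toNNReal (x : H)) (S.op t.toNNReal (B x)) (Set.Ici t) t := by
  rw [hasDerivWithinAt_iff_tendsto_slope, Set.Ici_sdiff_left]
  have h0 := (hgen x (B x)).1 (B.mem_graph x)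
  have hmap : Tendsto (fun s : ℝ => (s - t).toNNReal) (𝓝[>] t) (𝓝[>] 0) := by
    refine tendsto_nhdsWithin_iff.2 ⟨?_, ?_⟩
    · have : Tendsto (fun s : ℝ => (s - t).toNNReal) (𝓝 t) (𝓝 ((t - t).toNNReal)) :=
        (continuous_real_toNNReal.comp (continuous_id.sub continuous_const)).tendsto t
      simpa using this.mono_left nhdsWithin_le_nhds
    · filter_upwards [self_mem_nhdsWithin] with s hs
      simpa using hs
  have h1 := ((S.op t.toNNReal).continuous.tendsto _).comp (h0.comp hmap)
  refine h1.congr' ?_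
  filter_upwards [self_mem_nhdsWithin] with s hs
  have hs' : t < s := hs
  have hsum : s.toNNReal = t.toNNReal + (s - t).toNNReal := by
    rw [← Real.toNNReal_add ht (sub_nonneg.2 hs'.le), add_sub_cancel]
  have hc : ((s - t).toNNReal : ℝ) = s - t := Real.coe_toNNReal _ (sub_nonneg.2 hs'.le)
  simp only [Function.comp_apply, slope_def_module, hsum, S.op_add, ContinuousLinearMap.comp_apply,
    map_smul, map_sub, hc]
  rw [← Complex.ofReal_inv, Complex.coe_smul]

/-- The semigroup generated by `-A` acts on an eigenvector of `A` by an exponential factor. -/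
theorem C0Semigroup.op_eigenvector (S : C0Semigroup H) {A : H →ₗ.[ℂ] H}
    (hgen : S.IsGenerator (-A)) (x : A.domain) {l : ℝ} (hx : A x = (l : ℂ) • (x : H)) (t : ℝ≥0) :
    S.op t x = ((Real.exp (-l * t) : ℝ) : ℂ) • (x : H) := by
  let g : ℝ → H := fun s => S.op s.toNNReal (x : H)
  have hg : ∀ s, 0 ≤ s → HasDerivWithinAt g (-(l • g s)) (Set.Ici s) s := by
    intro s hs
    obtain ⟨x', hx1, hx2⟩ : ∃ x' : (-A).domain, (x' : H) = x ∧ (-A) x' = -((l : ℂ) • (x : H)) :=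
      ⟨⟨x, x.2⟩, rfl, by rw [← hx]; rfl⟩
    have h1 := S.hasDerivWithinAt_op hgen x' hs
    rw [hx1, hx2, map_neg, map_smul, Complex.coe_smul] at h1
    exact h1
  have hgc : Continuous g := (S.strongly_continuous x).comp continuous_real_toNNReal
  have hE : ∀ s : ℝ, HasDerivAt (fun s : ℝ => Real.exp (l * s)) (Real.exp (l * s) * l) s := by
    intro s
    simpa using ((hasDerivAt_id s).const_mul l).exp
  have hEc : Continuous fun s : ℝ => Real.exp (l * s) := by fun_prop
  -- The orbit solves `g' = -l g` from the right, so `exp (l s) g s` is constant.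
  have key := constant_of_has_deriv_right_zero (f := fun s : ℝ => Real.exp (l * s) • g s)
    (a := 0) (b := t) (hEc.smul hgc).continuousOn (by
      intro s hs
      have h1 := (hE s).hasDerivWithinAt.smul (hg s hs.1)
      have h2 : Real.exp (l * s) • -(l • g s) + (Real.exp (l * s) * l) • g s = 0 := by module
      rw [h2] at h1
      exact h1) t ⟨t.2, le_rfl⟩
  have h0 : g 0 = x := by simp [g, S.op_zero]
  have ht : g t = S.op t x := by simp [g]
  simp only [mul_zero, Real.exp_zero, one_smul, h0, ht] at key
  conv_rhs => rw [← key, Complex.coe_smul, smul_smul, ← Real.exp_add]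
  simp

variable [CompleteSpace H]

/-- An operator with compact resolvent which is bounded from below by `γ` has a compact
inverse after shifting by any `m < γ`. -/
theorem exists_compact_inverse {A : H →ₗ.[ℂ] H} (hc : HasCompactResolvent A) {γ m : ℝ}
    (hb : ∀ x : A.domain, γ * ‖(x : H)‖ ^ 2 ≤ (inner ℂ (A x) (x : H)).re) (hm : m < γ) :
    ∃ K : H →L[ℂ] H, IsCompactOperator K ∧
      (∀ f : H, ∃ h : K f ∈ A.domain, A ⟨K f, h⟩ - (m : ℂ) • K f = f) ∧
      ∀ x : A.domain, K (A x - (m : ℂ) • (x : H)) = x := by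
  obtain ⟨z, R, hR, hR1, hR2⟩ := hc
  have hinj : ∀ x : A.domain, A x = (m : ℂ) • (x : H) → (x : H) = 0 := by
    intro x hx
    have h1 := hb x
    rw [hx, inner_smul_left, inner_self_eq_norm_sq_to_K] at h1
    have h2 : ((starRingEnd ℂ) (m : ℂ) * ((‖(x : H)‖ : ℝ) : ℂ) ^ 2).re = m * ‖(x : H)‖ ^ 2 := by
      rw [Complex.conj_ofReal]; norm_cast
    have h3 : γ * ‖(x : H)‖ ^ 2 ≤ m * ‖(x : H)‖ ^ 2 := h1.trans_eq h2
    have h4 : ‖(x : H)‖ ^ 2 ≤ 0 := by nlinarith [sq_nonneg ‖(x : H)‖]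
    simpa using le_antisymm h4 (sq_nonneg _)
  have hAR : ∀ f, ∀ h : R f ∈ A.domain, A ⟨R f, h⟩ = z • R f - f := by
    intro f h
    obtain ⟨h', e⟩ := hR1 f
    rw [eq_sub_iff_add_eq, add_comm]
    exact (sub_eq_iff_eq_add.1 e).symm
  let w : ℂ := z - m
  -- On the domain `A - m = -(1 - w R)(z - A)`, so the inverse sought is `-R (1 - w R)⁻¹`. By the
  -- Fredholm alternative, if `1 - w R` were not invertible then `w⁻¹` would be an eigenvalue of
  -- `R`, which produces a nonzero vector in the kernel of `A - m`; `m < γ` forbids this.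
  have hunit : IsUnit (1 - w • R : H →L[ℂ] H) := by
    by_cases hw : w = 0
    · simp [hw]
    have hne : ¬ Module.End.HasEigenvalue (R : Module.End ℂ H) w⁻¹ := by
      intro he
      obtain ⟨v, hv⟩ := he.exists_hasEigenvector
      have hv1 : R v = w⁻¹ • v := hv.apply_eq_smul
      obtain ⟨h, -⟩ := hR1 v
      have hv2 : v = w • R v := by rw [hv1, smul_smul, mul_inv_cancel₀ hw, one_smul]
      have h0 : R v = 0 := by
        refine hinj ⟨R v, h⟩ ?_
        rw [hAR v h]
        change z • R v - v = (m : ℂ) • R v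
        nth_rw 2 [hv2]
        simp only [w]; module
      exact hv.2 (by rw [hv2, h0, smul_zero])
    have hres := (hR.hasEigenvalue_or_mem_resolventSet (inv_ne_zero hw)).resolve_left hne
    rw [spectrum.mem_resolventSet_iff] at hres
    have : (1 - w • R : H →L[ℂ] H) = (algebraMap ℂ (H →L[ℂ] H) w) *
        (algebraMap ℂ (H →L[ℂ] H) w⁻¹ - R) := by
      rw [mul_sub, ← map_mul, mul_inv_cancel₀ hw, map_one, ← Algebra.smul_def]
    rw [this]
    exact ((IsUnit.mk0 w hw).map (algebraMap ℂ (H →L[ℂ] H))).mul hres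
  obtain ⟨B, hB1, hB2⟩ := isUnit_iff_exists.1 hunit
  have hB1' : ∀ f, B f - w • R (B f) = f := fun f => by
    simpa using congrArg (fun T : H →L[ℂ] H => T f) hB1
  have hB2' : ∀ f, B (f - w • R f) = f := fun f => by
    simpa using congrArg (fun T : H →L[ℂ] H => T f) hB2
  refine ⟨-(R.comp B), (hR.comp_clm B).neg, ?_, ?_⟩
  · intro f
    obtain ⟨h, -⟩ := hR1 (B f)
    refine ⟨A.domain.neg_mem h, ?_⟩
    have e : (⟨(-(R.comp B)) f, A.domain.neg_mem h⟩ : A.domain) = -⟨R (B f), h⟩ := rfl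
    rw [e, LinearPMap.map_neg, hAR]
    change -(z • R (B f) - B f) - (m : ℂ) • -(R (B f)) = f
    conv_rhs => rw [← hB1' f]
    simp only [w]; module
  · intro x
    have h1 : A x - (m : ℂ) • (x : H) = -((z • (x : H) - A x) - w • R (z • (x : H) - A x)) := by
      rw [hR2 x]; simp only [w]; module
    change -(R (B _)) = _
    rw [h1, map_neg, map_neg, neg_neg, hB2', hR2]

/-- The semigroup generated by `-A`, where `A` is self-adjoint, bounded from below and has compact
resolvent, has an eigenvector for `exp (-t λ₁(A))`, and `exp (-t λ₁(A))` bounds its norm. -/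
theorem C0Semigroup.exists_eigenvector_and_norm_le [Nontrivial H] {A : H →ₗ.[ℂ] H}
    (hsa : IsSelfAdjoint A) (hb : BoundedFromBelow A) (hc : HasCompactResolvent A)
    (S : C0Semigroup H) (hgen : S.IsGenerator (-A)) :
    (∃ u : H, u ≠ 0 ∧
      ∀ t : ℝ≥0, S.op t u = ((Real.exp (-firstEigenvalue A * t) : ℝ) : ℂ) • u) ∧
    ∀ (t : ℝ≥0) (f : H), ‖S.op t f‖ ≤ Real.exp (-firstEigenvalue A * t) * ‖f‖ := by
  obtain ⟨γ, hγ⟩ := hb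
  -- The gap of exactly `1` gives `A - m ≥ 1`, whence `‖K f‖² ≤ ⟨f, K f⟩` for `K = (A - m)⁻¹`.
  obtain ⟨m, hm⟩ : ∃ m : ℝ, m = γ - 1 := ⟨_, rfl⟩
  obtain ⟨K, hK, hK1, hK2⟩ := exists_compact_inverse hc hγ (by linarith : m < γ)
  have hsymA : ∀ x y : A.domain, inner ℂ (A x) (y : H) = inner ℂ (x : H) (A y) := by
    have h := LinearPMap.adjoint_isFormalAdjoint hsa.dense_domain
    rwa [LinearPMap.isSelfAdjoint_def.1 hsa] at h
  have hKsym : (K : H →ₗ[ℂ] H).IsSymmetric := by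
    intro f g
    obtain ⟨hf, ef⟩ := hK1 f
    obtain ⟨hg, eg⟩ := hK1 g
    change inner ℂ (K f) g = inner ℂ f (K g)
    conv_lhs => rw [← eg]
    conv_rhs => rw [← ef]
    rw [inner_sub_right, inner_sub_left, ← hsymA ⟨K f, hf⟩ ⟨K g, hg⟩, inner_smul_left,
      inner_smul_right, Complex.conj_ofReal]
  have hKpos : ∀ f, ‖K f‖ ^ 2 ≤ (inner ℂ f (K f)).re := by
    intro f
    obtain ⟨hf, ef⟩ := hK1 f
    have hin : inner ℂ f (K f) = inner ℂ (A ⟨K f, hf⟩) (K f) - (m : ℂ) * ((‖K f‖ : ℝ) : ℂ) ^ 2 := by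
      conv_lhs => enter [2]; rw [← ef]
      rw [inner_sub_left, inner_smul_left, inner_self_eq_norm_sq_to_K, Complex.conj_ofReal]
      rfl
    rw [hin, Complex.sub_re]
    have h2 : ((m : ℂ) * ((‖K f‖ : ℝ) : ℂ) ^ 2).re = m * ‖K f‖ ^ 2 := by norm_cast
    have h1 := hγ ⟨K f, hf⟩
    have h3 : γ * ‖K f‖ ^ 2 - m * ‖K f‖ ^ 2 ≤
      (inner ℂ (A ⟨K f, hf⟩) (K f)).re - ((m : ℂ) * ((‖K f‖ : ℝ) : ℂ) ^ 2).re := by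
      rw [h2]; exact sub_le_sub_right h1 _
    refine le_trans (le_of_eq ?_) h3
    rw [hm]; ring
  have hKinj : ∀ f, K f = 0 → f = 0 := by
    intro f hf
    obtain ⟨h, e⟩ := hK1 f
    have : (⟨K f, h⟩ : A.domain) = 0 := Subtype.ext hf
    rw [this, LinearPMap.map_zero, hf, smul_zero, sub_zero] at e
    exact e.symm
  have hK0 : 0 < ‖K‖ := by
    rw [norm_pos_iff]
    rintro rfl
    obtain ⟨v, hv⟩ := exists_ne (0 : H)
    exact hv (hKinj v rfl)
  have heig : ∀ (κ : ℂ) (v : H), K v = κ • v → v ≠ 0 →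
      0 < κ.re ∧ κ.im = 0 ∧ κ.re ≤ ‖K‖ ∧ ‖κ‖ = κ.re := by
    intro κ v hv hv0
    have h1 := hKpos v
    have hvp : 0 < ‖v‖ := norm_pos_iff.2 hv0
    have h2 : 0 < ‖K v‖ := norm_pos_iff.2 fun h => hv0 (hKinj v h)
    have h3 : (inner ℂ v (K v)).re = κ.re * ‖v‖ ^ 2 := by
      rw [hv, inner_smul_right, inner_self_eq_norm_sq_to_K]
      have : (κ * ((‖v‖ : ℝ) : ℂ) ^ 2).re = κ.re * ‖v‖ ^ 2 := by
        rw [← Complex.ofReal_pow, Complex.re_mul_ofReal]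
      exact this
    have hre : 0 < κ.re := by
      have : 0 < κ.re * ‖v‖ ^ 2 := h3 ▸ lt_of_lt_of_le (by positivity) h1
      exact pos_of_mul_pos_left this (by positivity)
    have him : κ.im = 0 := by
      have hhe : Module.End.HasEigenvalue (K : H →ₗ[ℂ] H) κ :=
        Module.End.hasEigenvalue_of_hasEigenvector
          (Module.End.hasEigenvector_iff.2 ⟨Module.End.mem_eigenspace_iff.2 hv, hv0⟩)
      exact Complex.conj_eq_iff_im.1 (hKsym.conj_eigenvalue_eq_self hhe)
    have hn : ‖κ‖ = κ.re := by
      have : κ = (κ.re : ℂ) := Complex.ext rfl (by simpa using him)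
      rw [this, Complex.norm_real, Complex.ofReal_re, Real.norm_of_nonneg hre.le]
    refine ⟨hre, him, ?_, hn⟩
    have h4 := K.le_opNorm v
    rw [hv, norm_smul, hn] at h4
    exact le_of_mul_le_mul_right h4 hvp
  have hAeig : ∀ (κ : ℂ) (v : H), K v = κ • v → v ≠ 0 →
      ∃ h : v ∈ A.domain, A ⟨v, h⟩ = ((m + κ.re⁻¹ : ℝ) : ℂ) • v := by
    intro κ v hv hv0
    obtain ⟨hre, him, -⟩ := heig κ v hv hv0
    have hκ : κ = (κ.re : ℂ) := Complex.ext rfl (by simpa using him)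
    have hκ0 : κ ≠ 0 := by intro h; simp [h] at hre
    obtain ⟨h, e⟩ := hK1 (κ⁻¹ • v)
    have e1 : K (κ⁻¹ • v) = v := by rw [map_smul, hv, smul_smul, inv_mul_cancel₀ hκ0, one_smul]
    have hvd : v ∈ A.domain := e1 ▸ h
    refine ⟨hvd, ?_⟩
    have e2 : (⟨K (κ⁻¹ • v), h⟩ : A.domain) = ⟨v, hvd⟩ := Subtype.ext e1
    rw [e2, e1, sub_eq_iff_eq_add] at e
    rw [e, Complex.ofReal_add, Complex.ofReal_inv, ← hκ]
    module
  -- An eigenvalue `l` of `A` gives the eigenvalue `(l - m)⁻¹` of `K`, which lies in `(0, ‖K‖]`.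
  have hlow : ∀ l ∈ {l : ℝ | ∃ x : A.domain, (x : H) ≠ 0 ∧ A x = (l : ℂ) • (x : H)},
      m + ‖K‖⁻¹ ≤ l := by
    rintro l ⟨x, hx0, hx⟩
    have h1 := hK2 x
    rw [hx, ← sub_smul, map_smul] at h1
    have hlm : (l : ℂ) - m ≠ 0 := by
      intro h; rw [h, zero_smul] at h1; exact hx0 h1.symm
    have h2 : K x = ((l : ℂ) - m)⁻¹ • (x : H) := by
      conv_rhs => rw [← h1]
      rw [smul_smul, inv_mul_cancel₀ hlm, one_smul]
    obtain ⟨hre, -, hle, -⟩ := heig _ _ h2 hx0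
    have h3 : (((l : ℂ) - m)⁻¹).re = (l - m)⁻¹ := by
      rw [← Complex.ofReal_sub, ← Complex.ofReal_inv, Complex.ofReal_re]
    rw [h3] at hre hle
    have h5 := inv_anti₀ hre hle
    rw [inv_inv] at h5
    linarith
  -- Self-adjointness puts a point of modulus `‖K‖` in the spectrum, compactness makes it an
  -- eigenvalue, and positivity makes it equal to `‖K‖`.
  obtain ⟨v, hv0, hv⟩ : ∃ v : H, v ≠ 0 ∧ K v = ((‖K‖ : ℝ) : ℂ) • v := by
    obtain ⟨k, hk, hkn⟩ := spectrum.exists_nnnorm_eq_spectralRadius K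
    rw [K.spectralRadius_eq_nnnorm hKsym.isSelfAdjoint, ENNReal.coe_inj] at hkn
    have hkn' : ‖k‖ = ‖K‖ := congrArg NNReal.toReal hkn
    have hk0 : k ≠ 0 := by rw [← norm_pos_iff, hkn']; exact hK0
    obtain ⟨v, hv⟩ := ((hK.hasEigenvalue_iff_mem_spectrum hk0).2 hk).exists_hasEigenvector
    have hv1 : K v = k • v := hv.apply_eq_smul
    obtain ⟨hre, him, -, hn⟩ := heig k v hv1 hv.2
    refine ⟨v, hv.2, ?_⟩
    rw [hv1, ← hkn', hn]
    congr 1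
    exact Complex.ext rfl (by simpa using him)
  obtain ⟨hvd, hvA⟩ := hAeig _ v hv hv0
  rw [Complex.ofReal_re] at hvA
  have hfe : firstEigenvalue A = m + ‖K‖⁻¹ :=
    IsLeast.csInf_eq ⟨⟨⟨v, hvd⟩, hv0, hvA⟩, hlow⟩
  refine ⟨⟨v, hv0, fun t => ?_⟩, fun t => ?_⟩
  · rw [hfe]; exact S.op_eigenvector hgen ⟨v, hvd⟩ hvA t
  -- The norm bound is closed in `f`, so finite sums of eigenvectors of `K` suffice. Their summands
  -- are orthogonal, and `S(t)` multiplies each by a factor of size at most `exp (-λ₁ t)`.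
  have hdense : Dense ((⨆ κ, Module.End.eigenspace (K : Module.End ℂ H) κ : Submodule ℂ H) : Set H) := by
    exact Submodule.dense_iff_topologicalClosure_eq_top.2 <| Submodule.topologicalClosure_eq_top_iff.2
      (K.orthogonalComplement_iSup_eigenspaces_eq_bot hK hKsym)
  refine hdense.induction (P := fun f => ‖S.op t f‖ ≤ _ * ‖f‖) ?_
    (isClosed_le (by fun_prop) (by fun_prop))
  intro f hf
  obtain ⟨d, hd, rfl⟩ := (Submodule.mem_iSup_iff_exists_finsupp _ _).1 hf
  have hact : ∀ κ, ∃ c : ℂ, ‖c‖ ≤ Real.exp (-firstEigenvalue A * t) ∧ S.op t (d κ) = c • d κ := by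
    intro κ
    by_cases h0 : d κ = 0
    · exact ⟨0, by simp; positivity, by simp [h0]⟩
    have hκ : K (d κ) = κ • d κ := Module.End.mem_eigenspace_iff.1 (hd κ)
    obtain ⟨hκd, hκA⟩ := hAeig κ _ hκ h0
    refine ⟨_, ?_, S.op_eigenvector hgen ⟨d κ, hκd⟩ hκA t⟩
    rw [Complex.norm_real, Real.norm_of_nonneg (Real.exp_nonneg _), Real.exp_le_exp]
    exact mul_le_mul_of_nonneg_right (neg_le_neg (hfe ▸ hlow _ ⟨⟨_, hκd⟩, h0, hκA⟩)) t.2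
  choose c hc1 hc2 using hact
  have hV := hKsym.orthogonalFamily_eigenspaces
  have n1 : ‖∑ κ ∈ d.support, d κ‖ ^ 2 = ∑ κ ∈ d.support, ‖d κ‖ ^ 2 :=
    hV.norm_sum (fun κ => ⟨d κ, hd κ⟩) d.support
  have n2 : ‖∑ κ ∈ d.support, c κ • d κ‖ ^ 2 = ∑ κ ∈ d.support, ‖c κ • d κ‖ ^ 2 :=
    hV.norm_sum (fun κ => c κ • ⟨d κ, hd κ⟩) d.support
  rw [Finsupp.sum, map_sum]
  simp only [hc2]
  refine le_of_sq_le_sq ?_ (by positivity)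
  rw [mul_pow, n1, n2, Finset.mul_sum]
  refine Finset.sum_le_sum fun κ _ => ?_
  rw [← mul_pow, norm_smul]
  have := hc1 κ
  gcongr

end Hilbert

/-! ### The positive cone of complex `L²` -/

section Lattice

variable {α β : Type*} [MeasurableSpace α] [MeasurableSpace β] {μ : Measure α} {ν : Measure β}

theorem lipschitzWith_posRe : LipschitzWith 1 fun z : ℂ => ((max z.re 0 : ℝ) : ℂ) := by
  refine LipschitzWith.of_dist_le_mul fun z w => ?_
  rw [NNReal.coe_one, one_mul, Complex.dist_eq, Complex.dist_eq, ← Complex.ofReal_sub,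
    Complex.norm_real, Real.norm_eq_abs]
  calc |max z.re 0 - max w.re 0| ≤ |z.re - w.re| := abs_max_sub_max_le_abs _ _ _
    _ = |(z - w).re| := by rw [Complex.sub_re]
    _ ≤ ‖z - w‖ := Complex.abs_re_le_norm _

/-- The positive part of the real part of an `L²` function. -/
noncomputable def posRe (f : Lp ℂ 2 μ) : Lp ℂ 2 μ := lipschitzWith_posRe.compLp (by simp) f

theorem coeFn_posRe (f : Lp ℂ 2 μ) : ∀ᵐ x ∂μ, posRe f x = ((max (f x).re 0 : ℝ) : ℂ) :=
  lipschitzWith_posRe.coeFn_compLp _ f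

theorem nonneg_posRe (f : Lp ℂ 2 μ) : Nonneg (posRe f) := by
  filter_upwards [coeFn_posRe f] with x hx
  simp [hx]

theorem coeFn_sub_apply (f g : Lp ℂ 2 μ) : ∀ᵐ x ∂μ, (f - g) x = f x - g x := Lp.coeFn_sub f g

theorem coeFn_add_apply (f g : Lp ℂ 2 μ) : ∀ᵐ x ∂μ, (f + g) x = f x + g x := Lp.coeFn_add f g

theorem coeFn_neg_apply (f : Lp ℂ 2 μ) : ∀ᵐ x ∂μ, (-f) x = -f x := Lp.coeFn_neg f

theorem coeFn_smul_apply (c : ℂ) (f : Lp ℂ 2 μ) : ∀ᵐ x ∂μ, (c • f) x = c * f x :=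
  Lp.coeFn_smul c f

theorem eq_zero_of_ae {f : Lp ℂ 2 μ} (h : ∀ᵐ x ∂μ, f x = 0) : f = 0 :=
  Lp.ext (by filter_upwards [h, Lp.coeFn_zero ℂ 2 μ] with x h1 h2; rw [h1, h2]; rfl)

theorem eq_zero_of_nonneg_of_nonneg_neg {f : Lp ℂ 2 μ} (h : Nonneg f) (h' : Nonneg (-f)) :
    f = 0 := by
  refine eq_zero_of_ae ?_
  filter_upwards [h, h', coeFn_neg_apply f] with x h1 h2 h3
  rw [h3, Complex.neg_re] at h2
  exact Complex.ext (le_antisymm (neg_nonneg.1 h2.2) h1.2) h1.1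

/-- Every `L²` function is a combination of the positive parts of its real and imaginary parts. -/
theorem eq_posRe_combination (f : Lp ℂ 2 μ) :
    f = (posRe f - posRe (-f)) +
      Complex.I • (posRe (-(Complex.I • f)) - posRe (Complex.I • f)) := by
  refine Lp.ext ?_
  filter_upwards [coeFn_posRe f, coeFn_posRe (-f), coeFn_posRe (-(Complex.I • f)),
    coeFn_posRe (Complex.I • f), coeFn_neg_apply f, coeFn_neg_apply (Complex.I • f),
    coeFn_smul_apply Complex.I f, coeFn_sub_apply (posRe f) (posRe (-f)),
    coeFn_sub_apply (posRe (-(Complex.I • f))) (posRe (Complex.I • f)),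
    coeFn_smul_apply Complex.I (posRe (-(Complex.I • f)) - posRe (Complex.I • f)),
    coeFn_add_apply (posRe f - posRe (-f))
      (Complex.I • (posRe (-(Complex.I • f)) - posRe (Complex.I • f)))]
    with x h1 h2 h3 h4 h5 h6 h7 h8 h9 h10 h11
  rw [h11, h10, h9, h8, h1, h2, h3, h4, h5, h6, h7]
  have key : ∀ a : ℝ, max a 0 - max (-a) 0 = a := fun a => by
    rcases le_total a 0 with h | h <;> simp [h]
  refine Complex.ext ?_ ?_
  · simp [key]
  · simp [key]

theorem eq_zero_of_posRe_smul_eq_zero {f : Lp ℂ 2 μ} (h : ∀ c : ℂ, posRe (c • f) = 0) : f = 0 := by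
  have h1 := h 1
  have h2 := h (-1)
  have h3 := h Complex.I
  have h4 := h (-Complex.I)
  simp only [neg_smul, one_smul] at h1 h2 h4
  rw [eq_posRe_combination f, h1, h2, h3, h4]
  simp

theorem clm_ext_of_nonneg {T T' : Lp ℂ 2 μ →L[ℂ] Lp ℂ 2 ν} (h : ∀ f, Nonneg f → T f = T' f) :
    T = T' := by
  ext1 f
  rw [eq_posRe_combination f]
  simp only [map_add, map_sub, map_smul, h _ (nonneg_posRe _)]

theorem re_inner_eq_integral (f g : Lp ℂ 2 μ) :
    (inner ℂ f g).re = ∫ x, (inner ℂ (f x) (g x)).re ∂μ := by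
  rw [L2.inner_def]
  exact (integral_re (L2.integrable_inner (𝕜 := ℂ) f g)).symm

theorem im_inner_eq_integral (f g : Lp ℂ 2 μ) :
    (inner ℂ f g).im = ∫ x, (inner ℂ (f x) (g x)).im ∂μ := by
  rw [L2.inner_def]
  exact (integral_im (L2.integrable_inner (𝕜 := ℂ) f g)).symm

theorem inner_nonneg_of_nonneg {f g : Lp ℂ 2 μ} (hf : Nonneg f) (hg : Nonneg g) :
    0 ≤ (inner ℂ f g).re ∧ (inner ℂ f g).im = 0 := by
  rw [re_inner_eq_integral, im_inner_eq_integral]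
  constructor
  · refine integral_nonneg_of_ae ?_
    filter_upwards [hf, hg] with x h1 h2
    simpa [h1.1, h2.1] using mul_nonneg h2.2 h1.2
  · refine integral_eq_zero_of_ae ?_
    filter_upwards [hf, hg] with x h1 h2
    simp [h1.1, h2.1]

theorem ae_eq_zero_or_of_inner_eq_zero {f g : Lp ℂ 2 μ} (hf : Nonneg f) (hg : Nonneg g)
    (h : (inner ℂ f g).re = 0) : ∀ᵐ x ∂μ, f x = 0 ∨ g x = 0 := by
  have hint : Integrable (fun x => (inner ℂ (f x) (g x)).re) μ :=
    (L2.integrable_inner (𝕜 := ℂ) f g).re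
  rw [re_inner_eq_integral, integral_eq_zero_iff_of_nonneg_ae ?_ hint] at h
  · filter_upwards [h, hf, hg] with x h0 h1 h2
    have h3 : (g x).re * (f x).re = 0 := by simpa [h1.1, h2.1] using h0
    rcases mul_eq_zero.1 h3 with h4 | h4
    · exact Or.inr (Complex.ext h4 h2.1)
    · exact Or.inl (Complex.ext h4 h1.1)
  · filter_upwards [hf, hg] with x h1 h2
    simpa [h1.1, h2.1] using mul_nonneg h2.2 h1.2

/-- The restriction of an `L²` function to a measurable set, extended by zero. -/
noncomputable def restr {A : Set α} (hA : MeasurableSet A) (f : Lp ℂ 2 μ) : Lp ℂ 2 μ :=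
  ((Lp.memLp f).indicator hA).toLp _

theorem coeFn_restr {A : Set α} (hA : MeasurableSet A) (f : Lp ℂ 2 μ) :
    ∀ᵐ x ∂μ, restr hA f x = A.indicator f x :=
  MemLp.coeFn_toLp _

theorem Nonneg.restr {A : Set α} (hA : MeasurableSet A) {f : Lp ℂ 2 μ} (hf : Nonneg f) :
    Nonneg (restr hA f) := by
  filter_upwards [hf, coeFn_restr hA f] with x h1 h2
  rw [h2]
  by_cases hx : x ∈ A
  · simpa [hx] using h1
  · simp [hx]

theorem restr_add_restr_compl {A : Set α} (hA : MeasurableSet A) (f : Lp ℂ 2 μ) :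
    DisjL2.restr hA f + DisjL2.restr hA.compl f = f := by
  refine Lp.ext ?_
  filter_upwards [coeFn_restr hA f, coeFn_restr hA.compl f,
    coeFn_add_apply (DisjL2.restr hA f) (DisjL2.restr hA.compl f)] with x h1 h2 h3
  rw [h3, h1, h2]
  exact Set.indicator_self_add_compl_apply A f x

theorem inner_restr {A : Set α} (hA : MeasurableSet A) (f g : Lp ℂ 2 μ) :
    inner ℂ (DisjL2.restr hA f) g = ∫ x in A, inner ℂ (f x) (g x) ∂μ := by
  rw [L2.inner_def, ← integral_indicator hA]
  refine integral_congr_ae ?_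
  filter_upwards [coeFn_restr hA f] with x h1
  simp only [h1]
  by_cases hx : x ∈ A <;> simp [hx]

/-- Nonnegativity is detected by pairing with the restrictions of a strictly positive function. -/
theorem nonneg_of_inner_restr {w q : Lp ℂ 2 μ} (hw : Nonneg w) (hw0 : ∀ᵐ x ∂μ, w x ≠ 0)
    (h : ∀ (A : Set α) (hA : MeasurableSet A), 0 ≤ (inner ℂ (DisjL2.restr hA w) q).re ∧
      (inner ℂ (DisjL2.restr hA w) q).im = 0) : Nonneg q := by
  have hint := L2.integrable_inner (𝕜 := ℂ) w q
  have h1 : 0 ≤ᵐ[μ] fun x => (inner ℂ (w x) (q x)).re := by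
    refine ae_nonneg_of_forall_setIntegral_nonneg hint.re fun A hA _ => ?_
    have h2 := (h A hA).1
    rw [inner_restr] at h2
    exact h2.trans_eq (integral_re hint.integrableOn).symm
  have h2 : (fun x => (inner ℂ (w x) (q x)).im) =ᵐ[μ] 0 := by
    refine Integrable.ae_eq_zero_of_forall_setIntegral_eq_zero hint.im fun A hA _ => ?_
    have h2 := (h A hA).2
    rw [inner_restr] at h2
    exact (integral_im hint.integrableOn).trans h2
  filter_upwards [h1, h2, hw, hw0] with x h1 h2 h3 h4
  have hpos : 0 < (w x).re :=
    lt_of_le_of_ne h3.2 fun h => h4 (Complex.ext h.symm h3.1)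
  have e1 : 0 ≤ (q x).re * (w x).re := by simpa [h3.1] using h1
  have e2 : (q x).im * (w x).re = 0 := by simpa [h3.1] using h2
  exact ⟨(mul_eq_zero.1 e2).resolve_right hpos.ne', nonneg_of_mul_nonneg_left e1 hpos⟩

/-- Self-duality of the cone: testing `q` against the positive parts of `-q`, `i q` and `-i q` shows
that these vanish, leaving only `(Re q)⁺`. -/
theorem nonneg_of_forall_inner {q : Lp ℂ 2 μ} (h : ∀ f : Lp ℂ 2 μ, Nonneg f →
    0 ≤ (inner ℂ f q).re ∧ (inner ℂ f q).im = 0) : Nonneg q := by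
  -- Pointwise `(Re g)⁺ Re g = ((Re g)⁺)²`, so the pairing is `‖posRe g‖²`.
  have key : ∀ g : Lp ℂ 2 μ, (inner ℂ (posRe g) g).re ≤ 0 → posRe g = 0 := by
    intro g hg
    refine inner_self_eq_zero (𝕜 := ℂ) |>.1 ?_
    have hr := inner_nonneg_of_nonneg (nonneg_posRe g) (nonneg_posRe g)
    refine Complex.ext (le_antisymm ?_ hr.1) hr.2
    refine le_trans (le_of_eq ?_) hg
    rw [re_inner_eq_integral, re_inner_eq_integral]
    refine integral_congr_ae ?_
    filter_upwards [coeFn_posRe g] with x hx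
    rw [hx]
    simp only [RCLike.inner_apply, Complex.conj_ofReal, Complex.re_mul_ofReal, Complex.ofReal_re]
    rcases le_total (g x).re 0 with h | h <;> simp [h]
  have k1 := key (-q) (by
    rw [inner_neg_right, Complex.neg_re]
    linarith [(h _ (nonneg_posRe (-q))).1])
  have k2 := key (Complex.I • q) (by
    rw [inner_smul_right]
    simp [(h _ (nonneg_posRe (Complex.I • q))).2])
  have k3 := key (-(Complex.I • q)) (by
    rw [inner_neg_right, inner_smul_right]
    simp [(h _ (nonneg_posRe (-(Complex.I • q)))).2])
  have e := eq_posRe_combination q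
  rw [k1, k2, k3, sub_zero, sub_zero, smul_zero, add_zero] at e
  rw [e]
  exact nonneg_posRe q

end Lattice

/-! ### Positive operators and their eigenvectors -/

section PositiveOperators

variable {α β : Type*} [MeasurableSpace α] [MeasurableSpace β] {μ : Measure α} {ν : Measure β}

theorem PositiveOp.adjoint {T : Lp ℂ 2 μ →L[ℂ] Lp ℂ 2 ν} (hT : PositiveOp T) :
    PositiveOp (ContinuousLinearMap.adjoint T) := by
  intro g hg
  refine nonneg_of_forall_inner fun f hf => ?_
  rw [ContinuousLinearMap.adjoint_inner_right]
  exact inner_nonneg_of_nonneg (hT f hf) hg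

/-- A positive operator leaves invariant the closed ideal generated by a nonnegative
eigenvector. -/
theorem PositiveOp.map_closedIdeal {T : Lp ℂ 2 μ →L[ℂ] Lp ℂ 2 μ} (hT : PositiveOp T)
    {w : Lp ℂ 2 μ} (hw : Nonneg w) {e : ℂ} (he : T w = e • w) {f : Lp ℂ 2 μ}
    (hf : f ∈ closedIdeal μ {x | w x = 0}) : T f ∈ closedIdeal μ {x | w x = 0} := by
  have hA : MeasurableSet {x | w x = 0} :=
    (Lp.stronglyMeasurable w).measurable (measurableSet_singleton 0)
  -- With `A = {w = 0}`, `⟨w, T* (1_A y)⟩ = ⟨e w, 1_A y⟩ = 0`. Both entries of the first pairing are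
  -- nonnegative, so `T* (1_A y)` vanishes where `w ≠ 0`, while `f` vanishes where `w = 0`.
  have horth : ∀ y : Lp ℂ 2 μ, Nonneg y → inner ℂ (restr hA y) (T f) = 0 := by
    intro y hy
    have hq := hT.adjoint _ (hy.restr hA)
    rw [← ContinuousLinearMap.adjoint_inner_left]
    have h0 : inner ℂ w (ContinuousLinearMap.adjoint T (restr hA y)) = 0 := by
      rw [ContinuousLinearMap.adjoint_inner_right, he, inner_smul_left]
      refine mul_eq_zero_of_right _ ?_
      rw [L2.inner_def]
      refine integral_eq_zero_of_ae ?_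
      filter_upwards [coeFn_restr hA y] with x hx
      rw [hx]
      by_cases h : w x = 0 <;> simp [h]
    rw [L2.inner_def]
    refine integral_eq_zero_of_ae ?_
    filter_upwards [ae_eq_zero_or_of_inner_eq_zero hw hq (by rw [h0]; rfl), hf] with x h1 h2
    rcases h1 with h1 | h1
    · simp [h2 h1]
    · simp [h1]
  have hz : restr hA (T f) = 0 := by
    have hsymm : ∀ y, inner ℂ y (restr hA (T f)) = inner ℂ (restr hA y) (T f) := by
      intro y
      rw [← inner_conj_symm, inner_restr, inner_restr, ← integral_conj]
      simp only [inner_conj_symm]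
    refine eq_zero_of_nonneg_of_nonneg_neg (nonneg_of_forall_inner fun y hy => ?_)
      (nonneg_of_forall_inner fun y hy => ?_)
    · simp [hsymm, horth y hy]
    · simp [hsymm, horth y hy]
  have := coeFn_restr hA (T f)
  rw [hz] at this
  filter_upwards [this, Lp.coeFn_zero ℂ 2 μ] with x h1 h2 hx
  rw [Set.indicator_of_mem (show x ∈ {x | w x = 0} from hx)] at h1
  rw [← h1, h2]; rfl

theorem Nonneg.smul {f : Lp ℂ 2 μ} (hf : Nonneg f) {r : ℝ} (hr : 0 ≤ r) : Nonneg ((r : ℂ) • f) := by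
  filter_upwards [hf, coeFn_smul_apply (r : ℂ) f] with x h1 h2
  rw [h2]
  simpa [h1.1] using mul_nonneg hr h1.2

/-- The real part of `T f` is dominated by the image of the positive part of `Re f`. -/
theorem PositiveOp.re_le_posRe {T : Lp ℂ 2 μ →L[ℂ] Lp ℂ 2 ν} (hT : PositiveOp T) (f : Lp ℂ 2 μ) :
    ∀ᵐ x ∂ν, (T f x).re ≤ (T (posRe f) x).re := by
  have e : T f = (T (posRe f) - T (posRe (-f))) +
      Complex.I • (T (posRe (-(Complex.I • f))) - T (posRe (Complex.I • f))) := by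
    conv_lhs => rw [eq_posRe_combination f]
    simp only [map_add, map_sub, map_smul]
  have hp := fun g => hT _ (nonneg_posRe g)
  rw [e]
  filter_upwards [hp f, hp (-f), hp (-(Complex.I • f)), hp (Complex.I • f),
    coeFn_sub_apply (T (posRe f)) (T (posRe (-f))),
    coeFn_sub_apply (T (posRe (-(Complex.I • f)))) (T (posRe (Complex.I • f))),
    coeFn_smul_apply Complex.I (T (posRe (-(Complex.I • f))) - T (posRe (Complex.I • f))),
    coeFn_add_apply (T (posRe f) - T (posRe (-f)))
      (Complex.I • (T (posRe (-(Complex.I • f))) - T (posRe (Complex.I • f))))]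
    with x h1 h2 h3 h4 h5 h6 h7 h8
  rw [h8, h7, h6, h5]
  simp [h3.1, h4.1, h2.2]

/-- If the norm of a positive operator is bounded by an eigenvalue `e`, then positive parts of
eigenvectors for `e` are again eigenvectors. -/
theorem PositiveOp.posRe_eigenvector {T : Lp ℂ 2 μ →L[ℂ] Lp ℂ 2 μ} (hT : PositiveOp T) {e : ℝ}
    (he : 0 ≤ e) (hTe : ∀ f, ‖T f‖ ≤ e * ‖f‖) {u : Lp ℂ 2 μ} (hu : T u = (e : ℂ) • u) :
    T (posRe u) = (e : ℂ) • posRe u := by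
  set p := posRe u with hp
  -- `T p` dominates both `Re (T u) = e Re u` and `0`, hence `e p`.
  have hd : Nonneg (T p - (e : ℂ) • p) := by
    have h := hT.re_le_posRe u
    rw [hu] at h
    filter_upwards [h, hT p (nonneg_posRe u), coeFn_posRe u, coeFn_smul_apply (e : ℂ) u,
      coeFn_smul_apply (e : ℂ) p, coeFn_sub_apply (T p) ((e : ℂ) • p)] with x h1 h2 h3 h4 h5 h6
    rw [h6, h5, h3]
    rw [h4] at h1
    refine ⟨by simp [h2.1], ?_⟩
    have h7 : e * (u x).re ≤ (T p x).re := by simpa using h1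
    have h8 : e * max (u x).re 0 ≤ (T p x).re := by
      rw [mul_max_of_nonneg _ _ he, mul_zero]
      exact max_le h7 h2.2
    simpa using h8
  have h1 := (inner_nonneg_of_nonneg hd ((nonneg_posRe u).smul he)).1
  -- Writing `T p = d + e p` with `d ≥ 0`, the cross term is nonnegative, so `‖T p‖ ≤ e ‖p‖` forces
  -- `d = 0`.
  have h2 := norm_add_sq (𝕜 := ℂ) (T p - (e : ℂ) • p) ((e : ℂ) • p)
  rw [sub_add_cancel, norm_smul, Complex.norm_real, Real.norm_of_nonneg he] at h2
  have h3 : ‖T p‖ ^ 2 ≤ (e * ‖p‖) ^ 2 := by gcongr; exact hTe p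
  have h4 : ‖T p - (e : ℂ) • p‖ ^ 2 ≤ 0 := by
    have h1' : 0 ≤ RCLike.re (inner ℂ (T p - (e : ℂ) • p) ((e : ℂ) • p)) := h1
    linarith
  exact sub_eq_zero.1 (norm_eq_zero.1 (pow_eq_zero_iff two_ne_zero |>.1
    (le_antisymm h4 (sq_nonneg _))))

end PositiveOperators

/-! ### Perron–Frobenius theory for irreducible semigroups -/

section PerronFrobenius

variable {α : Type*} [MeasurableSpace α] {μ : Measure α}

/-- The ideal of functions vanishing on `{w = 0}` is invariant and contains `w ≠ 0`, so it is
everything. It then contains the indicator of `{w = 0}`, which is in `L²` by finiteness of the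
measure, so that set is null. -/
theorem C0Semigroup.Irreducible.ae_ne_zero [IsFiniteMeasure μ] {S : C0Semigroup (Lp ℂ 2 μ)}
    (hirr : S.Irreducible) (hpos : S.Positive) {w : Lp ℂ 2 μ} (hw : Nonneg w) (hw0 : w ≠ 0)
    {e : ℝ≥0 → ℝ} (he : ∀ t, S.op t w = (e t : ℂ) • w) : ∀ᵐ x ∂μ, w x ≠ 0 := by
  have hA : MeasurableSet {x | w x = 0} :=
    (Lp.stronglyMeasurable w).measurable (measurableSet_singleton 0)
  rcases hirr _ hA fun t f hf => (hpos t).map_closedIdeal hw (he t) hf with h | h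
  · have hmem : w ∈ closedIdeal μ {x | w x = 0} :=
      show ∀ᵐ x ∂μ, x ∈ {x | w x = 0} → w x = 0 from Eventually.of_forall fun x hx => hx
    rw [h] at hmem
    exact absurd ((Submodule.mem_bot ℂ).1 hmem) hw0
  · have hmem : indicatorConstLp 2 hA (measure_ne_top μ _) (1 : ℂ) ∈
        closedIdeal μ {x | w x = 0} := by rw [h]; trivial
    have hmem' : ∀ᵐ x ∂μ, x ∈ {x | w x = 0} →
      indicatorConstLp 2 hA (measure_ne_top μ _) (1 : ℂ) x = 0 := hmem
    filter_upwards [hmem', indicatorConstLp_coeFn (p := 2) (hs := hA)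
      (hμs := measure_ne_top μ _) (c := (1 : ℂ))] with x h1 h2 h3
    have h4 := h1 h3
    rw [h2, Set.indicator_of_mem (show x ∈ {x | w x = 0} from h3)] at h4
    exact one_ne_zero h4

theorem re_inner_eq_posRe_sub {w : Lp ℂ 2 μ} (hw : Nonneg w) (v : Lp ℂ 2 μ) :
    (inner ℂ w v).re = (inner ℂ w (posRe v)).re - (inner ℂ w (posRe (-v))).re := by
  have h := fun f => (inner_nonneg_of_nonneg hw (nonneg_posRe f)).2
  conv_lhs => rw [eq_posRe_combination v]
  simp [inner_add_right, inner_sub_right, inner_smul_right, h]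

/-- The ground state of an irreducible positive semigroup is, up to multiples, unique and
strictly positive. -/
theorem C0Semigroup.Irreducible.exists_ground_state [IsFiniteMeasure μ]
    {S : C0Semigroup (Lp ℂ 2 μ)} (hirr : S.Irreducible) (hpos : S.Positive) {e : ℝ≥0 → ℝ}
    (he : ∀ t, 0 ≤ e t) (hnorm : ∀ t f, ‖S.op t f‖ ≤ e t * ‖f‖)
    (hex : ∃ u : Lp ℂ 2 μ, u ≠ 0 ∧ ∀ t, S.op t u = (e t : ℂ) • u) :
    ∃ w : Lp ℂ 2 μ, Nonneg w ∧ (∀ᵐ x ∂μ, w x ≠ 0) ∧ (∀ t, S.op t w = (e t : ℂ) • w) ∧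
      ∀ v : Lp ℂ 2 μ, (∀ t, S.op t v = (e t : ℂ) • v) → ∃ c : ℂ, v = c • w := by
  obtain ⟨u, hu0, hu⟩ := hex
  have hsmul : ∀ v : Lp ℂ 2 μ, (∀ t, S.op t v = (e t : ℂ) • v) → ∀ (c : ℂ) (t),
      S.op t (c • v) = (e t : ℂ) • (c • v) := fun v hv c t => by
    rw [map_smul, hv, smul_comm]
  have hposRe : ∀ v : Lp ℂ 2 μ, (∀ t, S.op t v = (e t : ℂ) • v) → ∀ t,
      S.op t (posRe v) = (e t : ℂ) • posRe v := fun v hv t =>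
    (hpos t).posRe_eigenvector (he t) (hnorm t) (hv t)
  obtain ⟨c, hc⟩ : ∃ c : ℂ, posRe (c • u) ≠ 0 := by
    by_contra! h
    exact hu0 (eq_zero_of_posRe_smul_eq_zero h)
  set w := posRe (c • u)
  have hw := nonneg_posRe (c • u)
  have hwe := hposRe _ (hsmul u hu c)
  have hwne := hirr.ae_ne_zero hpos hw hc hwe
  refine ⟨w, hw, hwne, hwe, ?_⟩
  -- If `(Re v)⁺` were nonzero, it would be a ground state and so a.e. positive; then `(Re v)⁻ = 0`,
  -- and `⟨w, v⟩ = 0` contradicts the strict positivity of `w`.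
  have horth : ∀ v : Lp ℂ 2 μ, (∀ t, S.op t v = (e t : ℂ) • v) → inner ℂ w v = 0 →
      posRe v = 0 := by
    intro v hv hwv
    by_contra hp
    have hpne := hirr.ae_ne_zero hpos (nonneg_posRe v) hp (hposRe v hv)
    have hn : posRe (-v) = 0 := by
      refine eq_zero_of_ae ?_
      filter_upwards [hpne, coeFn_posRe v, coeFn_posRe (-v), coeFn_neg_apply v] with x h1 h2 h3 h4
      rw [h2] at h1
      rw [h3, h4]
      rcases le_total (v x).re 0 with h | h
      · simp [h] at h1
      · simp [h]
    have h1 := re_inner_eq_posRe_sub hw v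
    rw [hwv, hn, inner_zero_right, Complex.zero_re, sub_zero] at h1
    refine hp (eq_zero_of_ae ?_)
    filter_upwards [ae_eq_zero_or_of_inner_eq_zero hw (nonneg_posRe v) h1.symm, hwne] with x h2 h3
    exact h2.resolve_left h3
  intro v hv
  have hww : inner ℂ w w ≠ 0 := fun h => hc (inner_self_eq_zero.1 h)
  -- The coefficient of the projection onto `w`: every multiple of the remainder is an eigenvector
  -- orthogonal to `w`.
  refine ⟨inner ℂ w v / inner ℂ w w, sub_eq_zero.1 (eq_zero_of_posRe_smul_eq_zero fun a => ?_)⟩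
  refine horth _ (hsmul _ (fun t => ?_) a) ?_
  · rw [map_sub, hv, hsmul w hwe, smul_sub]
  · rw [inner_smul_right, inner_sub_right, inner_smul_right, div_mul_cancel₀ _ hww, sub_self,
      mul_zero]

end PerronFrobenius

/-! ### Disjointness-preserving operators and the modulus -/

section Disjointness

variable {α β : Type*} [MeasurableSpace α] [MeasurableSpace β] {μ : Measure α} {ν : Measure β}

/-- The restrictions of `f` to complementary sets are disjoint, hence so are their images under a
disjointness-preserving operator. -/
theorem DisjointnessPreserving.map_restr {U : Lp ℂ 2 μ →L[ℂ] Lp ℂ 2 ν} (hU : DisjointnessPreserving U)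
    {A : Set α} (hA : MeasurableSet A) (f : Lp ℂ 2 μ) :
    ∀ᵐ y ∂ν, U (restr hA f) y = 0 ∨ U (restr hA f) y = U f y := by
  have hdis : ∀ᵐ x ∂μ, min ‖restr hA f x‖ ‖restr hA.compl f x‖ = 0 := by
    filter_upwards [coeFn_restr hA f, coeFn_restr hA.compl f] with x h1 h2
    rw [h1, h2]
    by_cases hx : x ∈ A <;> simp [hx]
  have hsum := coeFn_add_apply (U (restr hA f)) (U (restr hA.compl f))
  rw [← map_add, restr_add_restr_compl hA f] at hsum
  filter_upwards [hU _ _ hdis, hsum] with y h1 h2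
  rcases min_choice ‖U (restr hA f) y‖ ‖U (restr hA.compl f) y‖ with h | h <;> rw [h] at h1
  · exact Or.inl (norm_eq_zero.1 h1)
  · rw [norm_eq_zero.1 h1, add_zero] at h2
    exact Or.inr h2.symm

/-- An operator mapping all restrictions of one strictly positive function to nonnegative
functions is positive. -/
theorem positiveOp_of_restr {T : Lp ℂ 2 μ →L[ℂ] Lp ℂ 2 ν} {w : Lp ℂ 2 μ} (hw : Nonneg w)
    (hw0 : ∀ᵐ x ∂μ, w x ≠ 0)
    (h : ∀ (A : Set α) (hA : MeasurableSet A), Nonneg (T (restr hA w))) : PositiveOp T := by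
  intro f hf
  -- By duality it suffices that `T* g ≥ 0` for `g ≥ 0`, and this is detected by `⟨1_A w, T* g⟩ = ⟨T
  -- (1_A w), g⟩`.
  refine nonneg_of_forall_inner fun g hg => ?_
  rw [← ContinuousLinearMap.adjoint_inner_left]
  refine inner_nonneg_of_nonneg (nonneg_of_inner_restr hw hw0 fun A hA => ?_) hf
  rw [ContinuousLinearMap.adjoint_inner_right]
  exact inner_nonneg_of_nonneg (h A hA) hg

/-- At almost every point `c U (1_A w)` is either `0` or `c U w`, hence nonnegative. -/
theorem DisjointnessPreserving.positiveOp_smul {U : Lp ℂ 2 μ →L[ℂ] Lp ℂ 2 ν}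
    (hU : DisjointnessPreserving U) {w : Lp ℂ 2 μ} (hw : Nonneg w) (hw0 : ∀ᵐ x ∂μ, w x ≠ 0)
    {c : ℂ} (hc : Nonneg (c • U w)) : PositiveOp (c • U) := by
  refine positiveOp_of_restr hw hw0 fun A hA => ?_
  filter_upwards [hU.map_restr hA w, hc, coeFn_smul_apply c (U w),
    coeFn_smul_apply c (U (DisjL2.restr hA w))] with y h1 h2 h3 h4
  rw [show (c • U) (DisjL2.restr hA w) = c • U (DisjL2.restr hA w) from rfl, h4]
  rcases h1 with h1 | h1
  · simp [h1]
  · rw [h1, ← h3]; exact h2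

/-- If `U w = 0`, the positivity criterion applies to both `U` and `-U`. -/
theorem DisjointnessPreserving.eq_zero {U : Lp ℂ 2 μ →L[ℂ] Lp ℂ 2 ν}
    (hU : DisjointnessPreserving U) {w : Lp ℂ 2 μ} (hw : Nonneg w) (hw0 : ∀ᵐ x ∂μ, w x ≠ 0)
    (h : U w = 0) : U = 0 := by
  have hp : ∀ c : ℂ, PositiveOp (c • U) := fun c => by
    refine hU.positiveOp_smul hw hw0 ?_
    rw [h, smul_zero]
    filter_upwards [Lp.coeFn_zero ℂ 2 ν] with y hy
    rw [hy]
    exact ⟨rfl, le_rfl⟩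
  refine clm_ext_of_nonneg fun f hf => ?_
  refine eq_zero_of_nonneg_of_nonneg_neg ?_ ?_
  · simpa using hp 1 f hf
  · simpa using hp (-1) f hf

theorem isModulus_smul {U : Lp ℂ 2 μ →L[ℂ] Lp ℂ 2 ν} {c : ℂ} (hc : ‖c‖ = 1)
    (hU : PositiveOp (c • U)) : IsModulus U (c • U) := by
  refine ⟨hU, fun f hf => ?_⟩
  filter_upwards [hU f hf, coeFn_smul_apply c (U f)] with y h1 h2
  have h3 : (c • U) f y = c * U f y := h2
  have h4 : ‖U f y‖ = ((c • U) f y).re := by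
    rw [← one_mul ‖U f y‖, ← hc, ← norm_mul, ← h3]
    have h5 : (c • U) f y = (((c • U) f y).re : ℂ) := Complex.ext rfl (by simpa using h1.1)
    conv_lhs => rw [h5]
    rw [Complex.norm_real, Real.norm_of_nonneg h1.2]
  rw [h4]
  exact Complex.ext rfl (by simpa using h1.1)

theorem IsModulus.unique {U V W : Lp ℂ 2 μ →L[ℂ] Lp ℂ 2 ν} (hV : IsModulus U V)
    (hW : IsModulus U W) : W = V :=
  clm_ext_of_nonneg fun f hf => Lp.ext <| by
    filter_upwards [hV.2 f hf, hW.2 f hf] with y h1 h2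
    rw [h1, h2]

theorem nontrivial_of_clm_ne_zero {U : Lp ℂ 2 μ →L[ℂ] Lp ℂ 2 ν} (hU : U ≠ 0) :
    Nontrivial (Lp ℂ 2 μ) ∧ Nontrivial (Lp ℂ 2 ν) := by
  obtain ⟨f, hf⟩ : ∃ f, U f ≠ 0 := by
    by_contra! h
    exact hU (ContinuousLinearMap.ext h)
  exact ⟨⟨f, 0, fun h => hf (by rw [h, map_zero])⟩, ⟨U f, 0, hf⟩⟩

/-- A disjointness-preserving operator intertwining two positive irreducible semigroups with the
same ground state energy is a unimodular multiple of a positive operator. -/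
theorem DisjointnessPreserving.exists_positiveOp_smul [IsFiniteMeasure μ] [IsFiniteMeasure ν]
    {A₁ : Lp ℂ 2 μ →ₗ.[ℂ] Lp ℂ 2 μ} {A₂ : Lp ℂ 2 ν →ₗ.[ℂ] Lp ℂ 2 ν}
    (hA₁_sa : IsSelfAdjoint A₁) (hA₁_below : BoundedFromBelow A₁) (hA₁_cpt : HasCompactResolvent A₁)
    (hA₂_sa : IsSelfAdjoint A₂) (hA₂_below : BoundedFromBelow A₂) (hA₂_cpt : HasCompactResolvent A₂)
    {S₁ : C0Semigroup (Lp ℂ 2 μ)} {S₂ : C0Semigroup (Lp ℂ 2 ν)}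
    (hS₁_gen : S₁.IsGenerator (-A₁)) (hS₁_pos : S₁.Positive) (hS₁_irr : S₁.Irreducible)
    (hS₂_gen : S₂.IsGenerator (-A₂)) (hS₂_pos : S₂.Positive) (hS₂_irr : S₂.Irreducible)
    (h_eig : firstEigenvalue A₁ = firstEigenvalue A₂)
    {U : Lp ℂ 2 μ →L[ℂ] Lp ℂ 2 ν} (hU_ne : U ≠ 0) (hU : DisjointnessPreserving U)
    (hU_int : ∀ t : ℝ≥0, U.comp (S₁.op t) = (S₂.op t).comp U) :
    ∃ c : ℂ, ‖c‖ = 1 ∧ PositiveOp (c • U) := by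
  obtain ⟨_, _⟩ := nontrivial_of_clm_ne_zero hU_ne
  obtain ⟨hex₁, hn₁⟩ := S₁.exists_eigenvector_and_norm_le hA₁_sa hA₁_below hA₁_cpt hS₁_gen
  obtain ⟨hex₂, hn₂⟩ := S₂.exists_eigenvector_and_norm_le hA₂_sa hA₂_below hA₂_cpt hS₂_gen
  rw [h_eig] at hex₁ hn₁
  obtain ⟨w₁, hw₁, hw₁0, hw₁e, -⟩ :=
    hS₁_irr.exists_ground_state hS₁_pos (fun t => Real.exp_nonneg _) hn₁ hex₁
  obtain ⟨w₂, hw₂, -, -, huniq⟩ :=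
    hS₂_irr.exists_ground_state hS₂_pos (fun t => Real.exp_nonneg _) hn₂ hex₂
  obtain ⟨a, ha⟩ := huniq (U w₁) fun t => by
    have h := congrArg (fun T : Lp ℂ 2 μ →L[ℂ] Lp ℂ 2 ν => T w₁) (hU_int t)
    simp only [ContinuousLinearMap.comp_apply, hw₁e, map_smul] at h
    exact h.symm
  have ha0 : a ≠ 0 := by
    rintro rfl
    exact hU_ne (hU.eq_zero hw₁ hw₁0 (by rw [ha, zero_smul]))
  have han : (‖a‖ : ℂ) ≠ 0 := by simpa using ha0
  -- The phase that turns `U w₁ = a w₂` into the nonnegative function `|a| w₂`.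
  refine ⟨(‖a‖ : ℂ) * a⁻¹, by simp [ha0], hU.positiveOp_smul hw₁ hw₁0 ?_⟩
  rw [ha, smul_smul, mul_assoc, inv_mul_cancel₀ ha0, mul_one]
  exact hw₂.smul (norm_nonneg a)

end Disjointness

end DisjL2

theorem mainTheorem12 {d : ℕ} (Ω₁ Ω₂ : Set (EuclideanSpace ℝ (Fin d)))
    (hΩ₁_open : IsOpen Ω₁) (hΩ₁_bdd : Bornology.IsBounded Ω₁) (hΩ₁_conn : IsConnected Ω₁)
    (hΩ₂_open : IsOpen Ω₂) (hΩ₂_bdd : Bornology.IsBounded Ω₂) (hΩ₂_conn : IsConnected Ω₂)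
    (A₁ : DisjL2.L2 Ω₁ →ₗ.[ℂ] DisjL2.L2 Ω₁) (A₂ : DisjL2.L2 Ω₂ →ₗ.[ℂ] DisjL2.L2 Ω₂)
    (hA₁_sa : IsSelfAdjoint A₁) (hA₁_below : DisjL2.BoundedFromBelow A₁)
    (hA₁_cpt : DisjL2.HasCompactResolvent A₁)
    (hA₂_sa : IsSelfAdjoint A₂) (hA₂_below : DisjL2.BoundedFromBelow A₂)
    (hA₂_cpt : DisjL2.HasCompactResolvent A₂)
    (S₁ : DisjL2.C0Semigroup (DisjL2.L2 Ω₁)) (S₂ : DisjL2.C0Semigroup (DisjL2.L2 Ω₂))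
    (hS₁_gen : S₁.IsGenerator (-A₁)) (hS₁_pos : S₁.Positive) (hS₁_irr : S₁.Irreducible)
    (hS₂_gen : S₂.IsGenerator (-A₂)) (hS₂_pos : S₂.Positive) (hS₂_irr : S₂.Irreducible)
    (h_eig : DisjL2.firstEigenvalue A₁ = DisjL2.firstEigenvalue A₂)
    (U : DisjL2.L2 Ω₁ →L[ℂ] DisjL2.L2 Ω₂) (hU_ne : U ≠ 0)
    (hU_disj : DisjL2.DisjointnessPreserving U)
    (hU_int : ∀ t : ℝ≥0, U.comp (S₁.op t) = (S₂.op t).comp U) :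
    ∃ V : DisjL2.L2 Ω₁ →L[ℂ] DisjL2.L2 Ω₂,
      DisjL2.IsModulus U V ∧
      (∀ W : DisjL2.L2 Ω₁ →L[ℂ] DisjL2.L2 Ω₂, DisjL2.IsModulus U W → W = V) ∧
      (∀ t : ℝ≥0, V.comp (S₁.op t) = (S₂.op t).comp V) ∧
      ∀ (c : ℝ) (τ : EuclideanSpace ℝ (Fin d) → EuclideanSpace ℝ (Fin d)),
        0 < c → Isometry τ → τ '' Ω₂ = Ω₁ →
        (∀ f : DisjL2.L2 Ω₁, ∀ᵐ y ∂(volume.restrict Ω₂), V f y = (c : ℂ) * f (τ y)) →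
        ∃ c₁ : ℂ, ∀ f : DisjL2.L2 Ω₁, ∀ᵐ y ∂(volume.restrict Ω₂), U f y = c₁ * f (τ y) := by
  have : IsFiniteMeasure ((volume : Measure (EuclideanSpace ℝ (Fin d))).restrict Ω₁) :=
    ⟨by simpa using hΩ₁_bdd.measure_lt_top⟩
  have : IsFiniteMeasure ((volume : Measure (EuclideanSpace ℝ (Fin d))).restrict Ω₂) :=
    ⟨by simpa using hΩ₂_bdd.measure_lt_top⟩
  obtain ⟨a, ha, hpos⟩ := hU_disj.exists_positiveOp_smul hA₁_sa hA₁_below hA₁_cpt hA₂_sa hA₂_below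
    hA₂_cpt hS₁_gen hS₁_pos hS₁_irr hS₂_gen hS₂_pos hS₂_irr h_eig hU_ne hU_int
  have hmod := DisjL2.isModulus_smul ha hpos
  have ha0 : a ≠ 0 := fun h => by simp [h] at ha
  refine ⟨a • U, hmod, fun W hW => hmod.unique hW, fun t => ?_, fun c τ _ _ _ hV => ?_⟩
  · rw [ContinuousLinearMap.smul_comp, hU_int, ContinuousLinearMap.comp_smul]
  -- Here the modulus is `a U` with `|a| = 1`, so its constant `c` is divided by the phase `a`.
  · refine ⟨a⁻¹ * c, fun f => ?_⟩
    filter_upwards [hV f, DisjL2.coeFn_smul_apply a (U f)] with y h1 h2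
    have h3 : a * U f y = c * f (τ y) := h2.symm.trans h1
    rw [mul_assoc, ← h3, inv_mul_cancel_left₀ ha0]
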